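/- Let $n\ge 1$, and let $\mathcal S_n(321)$ be the set of permutations $\pi$ of $\{1,\dots,n\}$ for which there are no $i<j<k$ with $\pi(i)>\pi(j)>\pi(k)$. Let $\mathbf A^{n-1}$ be the set of intervals $\{[i,j] : 1\le i\le j\le n-1\}$ ordered by inclusion, and let $\mathcal A(\mathbf A^{n-1})$ be its set of antichains. Antichain rowmotion $\rho_{\mathcal A}:\mathcal A(\mathbf A^{n-1})\to\mathcal A(\mathbf A^{n-1})$ sends an antichain $A$ to the set of minimal elements of the complement of the order ideal $\{x : x\le y \text{ for some } y\in A\}$. For $\pi\in\mathcal S_n(321)$ let $$\mathrm{Exc}(\pi)=\{[i,\pi(i)-1] : 1\le i\le n,\ \pi(i)>i\}.$$ Then $\mathrm{Exc}:\mathcal S_n(321)\to\mathcal A(\mathbf A^{n-1})$ is a bijection, the map $\rho_{\mathcal S}=\mathrm{Exc}^{-1}\circ\rho_{\mathcal A}\circ\mathrm{Exc}$ is a bijection from $\mathcal S_n(321)$ to itself, and the number of fixed points $\mathrm{fp}(\pi)=|\{i:\pi(i)=i\}|$ is $1$-mesic under $\rho_{\mathcal S}$: for every orbit $\mathcal O$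 of $\rho_{\mathcal S}$ on $\mathcal S_n(321)$, $$\frac{1}{|\mathcal O|}\sum_{\pi\in\mathcal O}\mathrm{fp}(\pi)=1.$$ -/

import Mathlib

namespace Rowmotion321

/-- `π` has no indices `i < j < k` with `π i > π j > π k`. -/
def Avoids321 {n : ℕ} (π : Equiv.Perm (Fin n)) : Prop :=
  ¬ ∃ i j k : Fin n, i < j ∧ j < k ∧ π k < π j ∧ π j < π i

/-- The set `S_n(321)` of `321`-avoiding permutations, with positions and values indexed from `0`. -/
abbrev Perm321 (n : ℕ) : Type := {π : Equiv.Perm (Fin n) // Avoids321 π}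

/-- The antichains of a poset. -/
abbrev Antichains (P : Type*) [PartialOrder P] : Type _ :=
  {A : Set P // IsAntichain (· ≤ ·) A}

/-- The positive root poset of type `A_{n-1}`: the intervals `[i, j]` in the chain with `n - 1`
elements, ordered by inclusion. The chain is `Fin (n - 1)`, so endpoints are indexed from `0`. -/
abbrev RootPoset (n : ℕ) : Type := NonemptyInterval (Fin (n - 1))

/-- Antichain rowmotion: `A` goes to the set of minimal elements of the complement of the order
ideal generated by `A`. -/
def antichainRowmotion {P : Type*} [PartialOrder P] (A : Antichains P) : Antichains P :=
  ⟨{x | Minimal (fun y => y ∉ lowerClosure A.1) x}, setOfPred_minimal_antichain _⟩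

/-- The excedances of a `321`-avoiding permutation have increasing values. -/
theorem Avoids321.excedance_lt {n : ℕ} {π : Equiv.Perm (Fin n)} (h : Avoids321 π)
    {i j : Fin n} (hij : i < j) (hj : j < π j) : π i < π j := by
  by_contra hlt
  have hne : π i ≠ π j := fun e => hij.ne (π.injective e)
  have hji : π j < π i := lt_of_le_of_ne (not_lt.1 hlt) hne.symm
  have hall : ∀ k ∈ Finset.Ioi j, π k ∈ Finset.Ioi (π j) := by
    intro k hk
    rw [Finset.mem_Ioi] at hk ⊢
    rcases lt_trichotomy (π j) (π k) with h1 | h1 | h1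
    · exact h1
    · exact absurd (π.injective h1) hk.ne
    · exact absurd ⟨i, j, k, hij, hk, h1, hji⟩ h
  have hc := Finset.card_le_card_of_injOn π hall π.injective.injOn
  rw [Fin.card_Ioi, Fin.card_Ioi] at hc
  have := (π j).isLt
  have : j.val < (π j).val := hj
  omega

/-- The map `Exc`: the set of all intervals `[i, π i - 1]` such that `(i, π i)` is an excedance
of `π`. -/
def Exc (n : ℕ) (π : Perm321 n) : Antichains (RootPoset n) :=
  ⟨{I | ∃ i : Fin n, i < π.1 i ∧ I.fst.val = i.val ∧ I.snd.val + 1 = (π.1 i).val}, by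
    rintro I ⟨i, hi, hi1, hi2⟩ J ⟨j, hj, hj1, hj2⟩ hne hle
    obtain ⟨h1, h2⟩ := NonemptyInterval.le_def.1 hle
    rw [Fin.le_def] at h1 h2
    rcases lt_trichotomy i j with hlt | rfl | hlt
    · have : i.val < j.val := hlt
      omega
    · apply hne
      apply NonemptyInterval.ext
      apply Prod.ext <;> apply Fin.ext <;> omega
    · have : (π.1 j).val < (π.1 i).val := π.2.excedance_lt hlt hi
      omega⟩

instance (n : ℕ) : Nonempty (Perm321 n) :=
  ⟨⟨1, fun ⟨_, _, _, h1, _, _, h2⟩ => lt_asymm h1 h2⟩⟩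

/-- Rowmotion `Exc⁻¹ ∘ ρ ∘ Exc` on `S_n(321)`, where `ρ` is antichain rowmotion. (`Exc` is a
bijection, so that `Function.invFun` is its two-sided inverse.) -/
noncomputable def rowmotion (n : ℕ) : Perm321 n → Perm321 n :=
  fun π => Function.invFun (Exc n) (antichainRowmotion (Exc n π))

/-- The number of fixed points of a permutation. -/
def fp {n : ℕ} (π : Perm321 n) : ℕ := (Finset.univ.filter fun i => π.1 i = i).card

/-- The set `{x, τ x, τ² x, …}`. For a bijection `τ`, if this set is finite, it is the orbit of
`x` under the cyclic group generated by `τ`. -/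
def orbit {S : Type*} (τ : S → S) (x : S) : Set S := {y | ∃ k : ℕ, τ^[k] x = y}

/-- The statistic `f` is `c`-mesic under `τ`: `τ` is a bijection with finite orbits, and the
average of `f` over each orbit is `c`. -/
def IsMesic {S : Type*} (τ : S → S) (f : S → ℚ) (c : ℚ) : Prop :=
  Function.Bijective τ ∧ ∀ x : S, (orbit τ x).Finite ∧
    (∑ᶠ y ∈ orbit τ x, f y) / ((orbit τ x).ncard : ℚ) = c

end Rowmotion321

/-!
The statistic `fp - 1` is a coboundary for rowmotion, so its sum over every orbit telescopes to
zero. The function it is the coboundary of is the number of excedances, which is the size of the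
antichain `Exc π`.

In a `321`-avoiding permutation the weak excedances are exactly the left-to-right maxima, and an
interval `[a, b]` lies in the order ideal generated by `Exc π` if and only if some `i ≤ a` has
`π i > b`. Hence `[a, b]` is a minimal element of the complement if and only if `b` is the largest
of the values `π 0, …, π a` and `a + 1` is a left-to-right maximum. So `[a, b] ↦ a + 1` is a
bijection from the antichain obtained by rowmotion to the nonzero weak excedances of `π`
(`bijOn_succFst`). As `0` is always a weak excedance, this gives `exc (ρ π) + 1 = exc π + fp π`
(`ncard_antichainRowmotion_Exc`).

That `Exc` is a bijection rests on the fact that a `321`-avoiding permutation is increasing both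
on its excedances and on the other positions. Its values on the excedances therefore determine
it, and conversely an antichain prescribes such values, which are extended by the increasing
bijection between the remaining positions and the remaining values.
-/

namespace Rowmotion321

/-! ### Monotonicity of permutations avoiding 321 -/

/-- Weak excedances are left-to-right maxima. -/
theorem Avoids321.lt_of_weak_excedance {n : ℕ} {π : Equiv.Perm (Fin n)} (h : Avoids321 π)
    {i j : Fin n} (hij : i < j) (hj : j ≤ π j) : π i < π j := by
  by_contra hlt
  have hji : π j < π i := lt_of_le_of_ne (not_lt.1 hlt) fun e => hij.ne' (π.injective e)
  -- Otherwise `i` and all positions after `j` have values above `π j`, which are too few.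
  have hall : ∀ k ∈ insert i (Finset.Ioi j), π k ∈ Finset.Ioi (π j) := by
    intro k hk
    rw [Finset.mem_insert, Finset.mem_Ioi] at hk
    rw [Finset.mem_Ioi]
    rcases hk with rfl | hk
    · exact hji
    · rcases lt_trichotomy (π j) (π k) with h1 | h1 | h1
      · exact h1
      · exact absurd (π.injective h1) hk.ne
      · exact absurd ⟨i, j, k, hij, hk, h1, hji⟩ h
  have hc := Finset.card_le_card_of_injOn π hall π.injective.injOn
  rw [Finset.card_insert_of_notMem (by simpa using hij.le), Fin.card_Ioi, Fin.card_Ioi] at hc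
  have := (π j).isLt
  have : j.val ≤ (π j).val := hj
  omega

theorem Avoids321.lt_of_not_excedance {n : ℕ} {π : Equiv.Perm (Fin n)} (h : Avoids321 π)
    {i j : Fin n} (hij : i < j) (hi : π i ≤ i) : π i < π j := by
  by_contra hlt
  have hji : π j < π i := lt_of_le_of_ne (not_lt.1 hlt) fun e => hij.ne' (π.injective e)
  -- Otherwise `j` and all positions before `i` have values below `π i`, which are too few.
  have hall : ∀ k ∈ insert j (Finset.Iio i), π k ∈ Finset.Iio (π i) := by
    intro k hk
    rw [Finset.mem_insert, Finset.mem_Iio] at hk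
    rw [Finset.mem_Iio]
    rcases hk with rfl | hk
    · exact hji
    · rcases lt_trichotomy (π k) (π i) with h1 | h1 | h1
      · exact h1
      · exact absurd (π.injective h1) hk.ne
      · exact absurd ⟨k, i, j, hk, hij, hji, h1⟩ h
  have hc := Finset.card_le_card_of_injOn π hall π.injective.injOn
  rw [Finset.card_insert_of_notMem (by simpa using hij.le), Fin.card_Iio, Fin.card_Iio] at hc
  have : (π i).val ≤ i.val := hi
  omega

/-! ### Excedances and antichains -/

/-- The left endpoint of an interval, as a position. -/
def fstPos {n : ℕ} (I : RootPoset n) : Fin n := ⟨I.fst.val, by have := I.fst.isLt; omega⟩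

/-- The right endpoint of an interval plus one, as a value: `Exc π` contains `[i, j]` precisely
when the excedance `i` has the value `j + 1`. -/
def sndVal {n : ℕ} (I : RootPoset n) : Fin n := ⟨I.snd.val + 1, by have := I.snd.isLt; omega⟩

/-- The position after the left endpoint of an interval. -/
def succFst {n : ℕ} (I : RootPoset n) : Fin n := ⟨I.fst.val + 1, by have := I.fst.isLt; omega⟩

theorem fstPos_lt_sndVal {n : ℕ} (I : RootPoset n) : fstPos I < sndVal I := by
  have : I.fst.val ≤ I.snd.val := I.fst_le_snd
  simp only [fstPos, sndVal, Fin.mk_lt_mk]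
  omega

/-- The interval attached to an excedance `i` with value `v`. -/
def excInterval {n : ℕ} (i v : Fin n) (h : i < v) : RootPoset n :=
  ⟨(⟨i.val, by have := v.isLt; have : i.val < v.val := h; omega⟩,
    ⟨v.val - 1, by have := v.isLt; have : i.val < v.val := h; omega⟩), by
      have : i.val < v.val := h
      simp only [Fin.mk_le_mk]; omega⟩

theorem rootPoset_ext {n : ℕ} {I J : RootPoset n} (h₁ : I.fst.val = J.fst.val)
    (h₂ : I.snd.val = J.snd.val) : I = J :=
  NonemptyInterval.ext (Prod.ext (Fin.ext h₁) (Fin.ext h₂))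

theorem rootPoset_le {n : ℕ} {I J : RootPoset n} :
    I ≤ J ↔ J.fst.val ≤ I.fst.val ∧ I.snd.val ≤ J.snd.val := by
  rw [NonemptyInterval.le_def, Fin.le_def, Fin.le_def]

theorem fst_injOn_of_isAntichain {n : ℕ} {A : Set (RootPoset n)} (hA : IsAntichain (· ≤ ·) A)
    {I J : RootPoset n} (hI : I ∈ A) (hJ : J ∈ A) (h : I.fst.val = J.fst.val) : I = J := by
  rcases le_total I.snd.val J.snd.val with h' | h'
  · exact hA.eq hI hJ (rootPoset_le.2 ⟨h.ge, h'⟩)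
  · exact (hA.eq hJ hI (rootPoset_le.2 ⟨h.le, h'⟩)).symm

theorem snd_lt_snd_of_isAntichain {n : ℕ} {A : Set (RootPoset n)} (hA : IsAntichain (· ≤ ·) A)
    {I J : RootPoset n} (hI : I ∈ A) (hJ : J ∈ A) (h : I.fst.val < J.fst.val) :
    I.snd.val < J.snd.val := by
  by_contra h'
  have := hA.eq hJ hI (rootPoset_le.2 ⟨h.le, not_lt.1 h'⟩)
  subst this
  exact lt_irrefl _ h

theorem mem_Exc {n : ℕ} {π : Perm321 n} {I : RootPoset n} :
    I ∈ (Exc n π).1 ↔ π.1 (fstPos I) = sndVal I := by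
  constructor
  · rintro ⟨i, -, h1, h2⟩
    have : fstPos I = i := Fin.ext h1
    rw [this]
    exact Fin.ext h2.symm
  · intro h
    exact ⟨fstPos I, h ▸ fstPos_lt_sndVal I, rfl, by rw [h]; rfl⟩

theorem eq_of_Exc_eq_of_lt {n : ℕ} {π σ : Perm321 n} (h : Exc n π = Exc n σ) {i : Fin n}
    (hi : i < π.1 i) : σ.1 i = π.1 i := by
  have hv : sndVal (excInterval i (π.1 i) hi) = π.1 i := by
    have : i.val < (π.1 i).val := hi
    apply Fin.ext
    change (π.1 i).val - 1 + 1 = (π.1 i).val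
    omega
  have hmem : excInterval i (π.1 i) hi ∈ (Exc n π).1 := mem_Exc.2 hv.symm
  rw [h, mem_Exc, hv] at hmem
  exact hmem

theorem Exc_injective (n : ℕ) : Function.Injective (Exc n) := by
  intro π σ h
  have hiff : ∀ i, i < π.1 i ↔ i < σ.1 i := fun i =>
    ⟨fun hi => by rwa [eq_of_Exc_eq_of_lt h hi], fun hi => by rwa [eq_of_Exc_eq_of_lt h.symm hi]⟩
  have hrest : (fun i : {i // ¬ i < π.1 i} => π.1 i) = fun i : {i // ¬ i < π.1 i} => σ.1 i := by
    have hπ : StrictMono fun i : {i // ¬ i < π.1 i} => π.1 i := fun i j hij =>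
      π.2.lt_of_not_excedance hij (not_lt.1 i.2)
    have hσ : StrictMono fun i : {i // ¬ i < π.1 i} => σ.1 i := fun i j hij =>
      σ.2.lt_of_not_excedance hij (not_lt.1 fun hi => i.2 ((hiff _).2 hi))
    rw [← StrictMono.range_inj hπ hσ]
    apply Set.Subset.antisymm
    · rintro _ ⟨i, rfl⟩
      refine ⟨⟨σ.1.symm (π.1 i), fun hj => ?_⟩, by simp⟩
      have := eq_of_Exc_eq_of_lt h hj
      rw [Equiv.apply_symm_apply] at this
      rw [← π.1.injective this] at hj
      exact i.2 hj
    · rintro _ ⟨i, rfl⟩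
      refine ⟨⟨π.1.symm (σ.1 i), fun hj => ?_⟩, by simp⟩
      have := eq_of_Exc_eq_of_lt h hj
      rw [Equiv.apply_symm_apply] at this
      rw [σ.1.injective this] at hj
      exact i.2 hj
  apply Subtype.ext
  apply Equiv.ext
  intro i
  by_cases hi : i < π.1 i
  · exact (eq_of_Exc_eq_of_lt h hi).symm
  · exact congrFun hrest ⟨i, hi⟩

theorem Exc_surjective (n : ℕ) : Function.Surjective (Exc n) := by
  classical
  rintro ⟨A, hA⟩
  have hfst : Set.InjOn (fstPos (n := n)) A := fun I hI J hJ h =>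
    fst_injOn_of_isAntichain hA hI hJ (Fin.mk.inj h)
  have hmono : ∀ I ∈ A, ∀ J ∈ A, fstPos I < fstPos J → sndVal I < sndVal J :=
    fun I hI J hJ h => Nat.succ_lt_succ (snd_lt_snd_of_isAntichain hA hI hJ h)
  have hsnd : Set.InjOn (sndVal (n := n)) A := by
    intro I hI J hJ h
    rcases lt_trichotomy (fstPos I) (fstPos J) with h' | h' | h'
    · exact absurd h (hmono I hI J hJ h').ne
    · exact hfst hI hJ h'
    · exact absurd h (hmono J hJ I hI h').ne'
  let e : {i // i ∈ fstPos '' A} ≃ {v // v ∈ sndVal '' A} :=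
    (Equiv.Set.imageOfInjOn fstPos A hfst).symm.trans (Equiv.Set.imageOfInjOn sndVal A hsnd)
  have hcard : Fintype.card {i // ¬ i ∈ fstPos '' A} = Fintype.card {v // ¬ v ∈ sndVal '' A} :=
    Fintype.card_congr e.toCompl
  let e' : {i // ¬ i ∈ fstPos '' A} ≃o {v // ¬ v ∈ sndVal '' A} :=
    (Fintype.orderIsoFinOfCardEq _ hcard).symm.trans (Fintype.orderIsoFinOfCardEq _ rfl)
  let π : Equiv.Perm (Fin n) := Equiv.subtypeCongr e e'.toEquiv
  have hπA : ∀ I ∈ A, π (fstPos I) = sndVal I := by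
    intro I hI
    have hI' : fstPos I ∈ fstPos '' A := ⟨I, hI, rfl⟩
    have hsymm : (Equiv.Set.imageOfInjOn fstPos A hfst).symm ⟨fstPos I, hI'⟩ = ⟨I, hI⟩ :=
      (Equiv.symm_apply_eq _).2 rfl
    have he : e ⟨fstPos I, hI'⟩ = ⟨sndVal I, ⟨I, hI, rfl⟩⟩ :=
      congrArg (Equiv.Set.imageOfInjOn sndVal A hsnd) hsymm
    simp only [π, Equiv.subtypeCongr, Equiv.trans_apply, Equiv.sumCompl_symm_apply_of_pos hI',
      Equiv.sumCongr_apply, Sum.map_inl, he, Equiv.sumCompl_apply_inl]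
  have hπc : ∀ i (hi : ¬ i ∈ fstPos '' A), π i = e' ⟨i, hi⟩ := by
    intro i hi
    simp only [π, Equiv.subtypeCongr, Equiv.trans_apply, Equiv.sumCompl_symm_apply_of_neg hi,
      Equiv.sumCongr_apply, Sum.map_inr, Equiv.sumCompl_apply_inr]
    rfl
  have hπc' : ∀ i j, ¬ i ∈ fstPos '' A → ¬ j ∈ fstPos '' A → i < j → π i < π j := by
    intro i j hi hj hij
    rw [hπc i hi, hπc j hj]
    exact e'.strictMono (show (⟨i, hi⟩ : {i // ¬ i ∈ fstPos '' A}) < ⟨j, hj⟩ from hij)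
  have hπA' : ∀ i j, i ∈ fstPos '' A → j ∈ fstPos '' A → i < j → π i < π j := by
    rintro _ _ ⟨I, hI, rfl⟩ ⟨J, hJ, rfl⟩ hij
    rw [hπA I hI, hπA J hJ]
    exact hmono I hI J hJ hij
  have hle : ∀ i, ¬ i ∈ fstPos '' A → π i ≤ i := by
    intro i hi
    by_contra hlt
    -- Otherwise all positions from `i` on have values above `i`, which are too few.
    have hall : ∀ k ∈ Finset.Ici i, π k ∈ Finset.Ioi i := by
      intro k hk
      rw [Finset.mem_Ici] at hk
      rw [Finset.mem_Ioi]
      by_cases hkA : k ∈ fstPos '' A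
      · obtain ⟨I, hI, rfl⟩ := hkA
        rw [hπA I hI]
        exact hk.trans_lt (fstPos_lt_sndVal I)
      · rcases hk.eq_or_lt with rfl | hk
        · exact not_le.1 hlt
        · exact (not_le.1 hlt).trans (hπc' _ _ hi hkA hk)
    have hc := Finset.card_le_card_of_injOn π hall π.injective.injOn
    rw [Fin.card_Ici, Fin.card_Ioi] at hc
    have := i.isLt
    omega
  have havoid : Avoids321 π := by
    -- Two of three positions lie both in the image of `A` or both outside it.
    rintro ⟨i, j, k, hij, hjk, hkj, hji⟩
    have key : ∀ a b, a < b → π b < π a → (a ∈ fstPos '' A ↔ ¬ b ∈ fstPos '' A) := by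
      intro a b hab hba
      by_cases ha : a ∈ fstPos '' A <;> by_cases hb : b ∈ fstPos '' A
      · exact absurd (hπA' a b ha hb hab) hba.not_gt
      · simp [ha, hb]
      · simp [ha, hb]
      · exact absurd (hπc' a b ha hb hab) hba.not_gt
    have h1 := key i j hij hji
    have h2 := key j k hjk hkj
    have h3 := key i k (hij.trans hjk) (hkj.trans hji)
    tauto
  refine ⟨⟨π, havoid⟩, Subtype.ext (Set.ext fun I => ?_)⟩
  rw [mem_Exc]
  constructor
  · intro h
    have hI : fstPos I ∈ fstPos '' A := by
      by_contra hI
      have := hle _ hI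
      rw [show π (fstPos I) = sndVal I from h] at this
      exact (fstPos_lt_sndVal I).not_ge this
    obtain ⟨J, hJ, hJI⟩ := hI
    have h2 : sndVal J = sndVal I := by rw [← hπA J hJ, hJI]; exact h
    have : J = I := rootPoset_ext (Fin.mk.inj hJI)
      (Nat.succ_injective (Fin.mk.inj h2))
    exact this ▸ hJ
  · exact hπA I

/-! ### Bijectivity of rowmotion -/

/-- Over a finite poset the minimal elements of the complement of an ideal determine the ideal,
and the ideal determines its maximal elements. -/
theorem antichainRowmotion_injective {P : Type*} [PartialOrder P] [Finite P] :
    Function.Injective (antichainRowmotion (P := P)) := by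
  have hmem : ∀ (A : Antichains P) (x : P),
      x ∉ lowerClosure A.1 ↔ ∃ y ∈ (antichainRowmotion A).1, y ≤ x := by
    intro A x
    constructor
    · intro hx
      obtain ⟨y, hyx, hy⟩ :=
        (Set.toFinite {y | y ∉ lowerClosure A.1}).exists_le_minimal (a := x) hx
      exact ⟨y, hy, hyx⟩
    · rintro ⟨y, hy, hyx⟩ hx
      exact hy.1 ((lowerClosure A.1).lower hyx hx)
  intro A B h
  have hl : lowerClosure A.1 = lowerClosure B.1 := by
    apply LowerSet.ext
    ext x
    have := hmem A x
    rw [h, ← hmem B x] at this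
    exact not_iff_not.1 this
  have hsub : ∀ A B : Antichains P, lowerClosure A.1 = lowerClosure B.1 → A.1 ⊆ B.1 := by
    intro A B hl x hx
    have hxB : x ∈ lowerClosure B.1 := hl ▸ subset_lowerClosure hx
    obtain ⟨y, hy, hxy⟩ := mem_lowerClosure.1 hxB
    have hyA : y ∈ lowerClosure A.1 := hl ▸ subset_lowerClosure hy
    obtain ⟨z, hz, hyz⟩ := mem_lowerClosure.1 hyA
    have := A.2.eq hx hz (hxy.trans hyz)
    subst this
    exact le_antisymm hxy hyz ▸ hy
  exact Subtype.ext ((hsub A B hl).antisymm (hsub B A hl.symm))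

theorem Exc_rowmotion (n : ℕ) (π : Perm321 n) :
    Exc n (rowmotion n π) = antichainRowmotion (Exc n π) :=
  Function.rightInverse_invFun (Exc_surjective n) _

instance finite_rootPoset (n : ℕ) : Finite (RootPoset n) :=
  Finite.of_injective _ NonemptyInterval.toProd_injective

theorem rowmotion_bijective (n : ℕ) : Function.Bijective (rowmotion n) := by
  apply Function.Injective.bijective_of_finite
  intro π σ h
  apply Exc_injective n
  apply antichainRowmotion_injective
  rw [← Exc_rowmotion, ← Exc_rowmotion, h]

/-! ### Rowmotion and the number of excedances -/

theorem mem_lowerClosure_Exc {n : ℕ} {π : Perm321 n} {I : RootPoset n} :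
    I ∈ lowerClosure (Exc n π).1 ↔ ∃ i : Fin n, i.val ≤ I.fst.val ∧ I.snd.val < (π.1 i).val := by
  rw [mem_lowerClosure]
  constructor
  · rintro ⟨J, hJ, hIJ⟩
    obtain ⟨h1, h2⟩ := rootPoset_le.1 hIJ
    refine ⟨fstPos J, h1, ?_⟩
    rw [mem_Exc.1 hJ]
    exact Nat.lt_succ_of_le h2
  · rintro ⟨i, h1, h2⟩
    have h3 : I.fst.val ≤ I.snd.val := I.fst_le_snd
    have hi : i < π.1 i := Fin.lt_def.2 (by omega)
    refine ⟨excInterval i (π.1 i) hi, ⟨i, hi, rfl, ?_⟩, rootPoset_le.2 ⟨h1, ?_⟩⟩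
    · change (π.1 i).val - 1 + 1 = _
      omega
    · change _ ≤ (π.1 i).val - 1
      omega

theorem bijOn_fstPos {n : ℕ} (π : Perm321 n) :
    Set.BijOn fstPos (Exc n π).1 {i | i < π.1 i} := by
  refine ⟨fun I hI => ?_, fun I hI J hJ h =>
    fst_injOn_of_isAntichain (Exc n π).2 hI hJ (Fin.mk.inj h), fun i hi => ?_⟩
  · rw [Set.mem_ofPred_eq, mem_Exc.1 hI]
    exact fstPos_lt_sndVal I
  · have hi' : i.val < (π.1 i).val := hi
    refine ⟨excInterval i (π.1 i) hi, ⟨i, hi, rfl, ?_⟩, rfl⟩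
    change (π.1 i).val - 1 + 1 = _
    omega

theorem exists_le_and_le_apply {n : ℕ} (π : Equiv.Perm (Fin n)) (a : Fin n) :
    ∃ i ≤ a, a ≤ π i := by
  by_contra! h
  have hc := Finset.card_le_card_of_injOn (s := Finset.Iic a) (t := Finset.Iio a) π
    (fun i hi => Finset.mem_Iio.2 (h i (Finset.mem_Iic.1 hi))) π.injective.injOn
  rw [Fin.card_Iic, Fin.card_Iio] at hc
  omega

theorem exists_lt_and_le_apply {n : ℕ} (π : Equiv.Perm (Fin n)) {c : Fin n} (hc : π c < c) :
    ∃ i < c, c ≤ π i := by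
  obtain ⟨i, hi, h⟩ := exists_le_and_le_apply π c
  refine ⟨i, lt_of_le_of_ne hi ?_, h⟩
  rintro rfl
  exact hc.not_ge h

/-- The minimal intervals outside the ideal generated by `Exc π` correspond to the weak excedances
of `π` other than `0`. -/
theorem bijOn_succFst {n : ℕ} (π : Perm321 n) :
    Set.BijOn succFst (antichainRowmotion (Exc n π)).1 {c | 0 < c.val ∧ c ≤ π.1 c} := by
  refine ⟨fun I hI => ⟨Nat.succ_pos _, ?_⟩, fun I hI J hJ h =>
    fst_injOn_of_isAntichain (antichainRowmotion (Exc n π)).2 hI hJ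
      (Nat.succ_injective (Fin.mk.inj h)), ?_⟩
  · obtain ⟨hI1, hI2⟩ := hI
    by_contra hlt
    rw [not_le] at hlt
    apply hI1
    rw [mem_lowerClosure_Exc]
    rcases (show I.fst.val ≤ I.snd.val from I.fst_le_snd).eq_or_lt with hab | hab
    · obtain ⟨i, hi, h⟩ := exists_lt_and_le_apply π.1 hlt
      have hi' : i.val < I.fst.val + 1 := hi
      have h' : I.fst.val + 1 ≤ (π.1 i).val := h
      exact ⟨i, by omega, by omega⟩
    · -- The interval with left endpoint moved up by one is in the ideal, by minimality.
      let J : RootPoset n := ⟨(⟨I.fst.val + 1, by have := I.snd.isLt; omega⟩, I.snd), hab⟩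
      have hJI : J ≤ I := rootPoset_le.2 ⟨Nat.le_succ _, le_rfl⟩
      have hJ : J ∈ lowerClosure (Exc n π).1 := by
        by_contra hJ
        have : I.fst.val + 1 ≤ I.fst.val := (rootPoset_le.1 (hI2 hJ hJI)).1
        omega
      obtain ⟨i, hi, h⟩ := mem_lowerClosure_Exc.1 hJ
      have hi' : i.val ≤ I.fst.val + 1 := hi
      have h' : I.snd.val < (π.1 i).val := h
      have hne : i.val ≠ I.fst.val + 1 := by
        intro he
        have : i = succFst I := Fin.ext he
        rw [this] at h'
        have hlt' : (π.1 (succFst I)).val < I.fst.val + 1 := hlt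
        omega
      exact ⟨i, by omega, h'⟩
  · rintro c ⟨hc0, hc⟩
    have hc' : c.val ≤ (π.1 c).val := hc
    have hcn := (π.1 c).isLt
    let a : Fin n := ⟨c.val - 1, by omega⟩
    -- The right endpoint is the maximum of the values at positions before `c`.
    obtain ⟨m, hm, hmax⟩ := Finset.exists_max_image (Finset.Iic a) π.1 ⟨a, Finset.mem_Iic.2 le_rfl⟩
    have hma : m.val ≤ c.val - 1 := Fin.le_def.1 (Finset.mem_Iic.1 hm)
    have hmc : (π.1 m).val < (π.1 c).val :=
      π.2.lt_of_weak_excedance (Fin.lt_def.2 (by omega)) hc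
    have ham : c.val - 1 ≤ (π.1 m).val := by
      obtain ⟨i, hi, h⟩ := exists_le_and_le_apply π.1 a
      exact h.trans (hmax i (Finset.mem_Iic.2 hi))
    let I : RootPoset n := ⟨(⟨c.val - 1, by omega⟩, ⟨(π.1 m).val, by omega⟩), ham⟩
    refine ⟨I, ⟨?_, ?_⟩, Fin.ext (Nat.sub_add_cancel hc0)⟩
    · intro hI
      obtain ⟨i, hi, h⟩ := mem_lowerClosure_Exc.1 hI
      exact (hmax i (Finset.mem_Iic.2 hi)).not_gt h
    · intro J hJ hJI
      obtain ⟨h1, h2⟩ := rootPoset_le.1 hJI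
      replace h1 : c.val - 1 ≤ J.fst.val := h1
      replace h2 : J.snd.val ≤ (π.1 m).val := h2
      have hJc : J.fst.val < c.val := by
        by_contra hJc
        exact hJ (mem_lowerClosure_Exc.2 ⟨c, by omega, by omega⟩)
      have hJm : (π.1 m).val ≤ J.snd.val := by
        by_contra hJm
        exact hJ (mem_lowerClosure_Exc.2 ⟨m, by omega, by omega⟩)
      exact rootPoset_le.2 ⟨show J.fst.val ≤ c.val - 1 by omega, hJm⟩

/-- Both sides count the weak excedances of `π`; on the left, the summand `1` stands for the
weak excedance `0`. -/
theorem ncard_antichainRowmotion_Exc {n : ℕ} (hn : 1 ≤ n) (π : Perm321 n) :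
    (antichainRowmotion (Exc n π)).1.ncard + 1 = (Exc n π).1.ncard + fp π := by
  have h0 : (⟨0, hn⟩ : Fin n) ∉ {c : Fin n | 0 < c.val ∧ c ≤ π.1 c} := fun h => lt_irrefl _ h.1
  have hfp : fp π = {i : Fin n | π.1 i = i}.ncard := by
    rw [Set.ncard_eq_toFinset_card', fp]
    congr 1
    ext; simp
  rw [(bijOn_succFst π).ncard_eq, (bijOn_fstPos π).ncard_eq, ← Set.ncard_insert_of_notMem h0, hfp,
    ← Set.ncard_union_eq]
  · congr 1
    ext c
    simp only [Set.mem_insert_iff, Set.mem_ofPred_eq, Set.mem_union, Fin.ext_iff, Fin.le_def,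
      Fin.lt_def]
    rcases Nat.eq_zero_or_pos c.val with hc | hc <;> omega
  · rw [Set.disjoint_left]
    intro i hi hi'
    exact (ne_of_gt hi) hi'

/-! ### Sums over orbits -/

/-- A function that is `c` plus a coboundary is `c`-mesic. -/
theorem isMesic_of_coboundary {S : Type*} [Finite S] {τ : S → S} (hτ : Function.Bijective τ)
    {f g : S → ℚ} {c : ℚ} (h : ∀ x, f x = c + (g (τ x) - g x)) : IsMesic τ f c := by
  refine ⟨hτ, fun x => ⟨Set.toFinite _, ?_⟩⟩
  have hfin : (orbit τ x).Finite := Set.toFinite _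
  have hmaps : Set.MapsTo τ (orbit τ x) (orbit τ x) := by
    rintro _ ⟨k, rfl⟩
    exact ⟨k + 1, Function.iterate_succ_apply' τ k x⟩
  have hbij : Set.BijOn τ (orbit τ x) (orbit τ x) :=
    (hfin.injOn_iff_bijOn_of_mapsTo hmaps).1 hτ.injective.injOn
  have hsum : ∑ᶠ y ∈ orbit τ x, g (τ y) = ∑ᶠ y ∈ orbit τ x, g y :=
    finsum_mem_eq_of_bijOn τ hbij fun _ _ => rfl
  have hpos : ((orbit τ x).ncard : ℚ) ≠ 0 :=
    Nat.cast_ne_zero.2 (Set.ncard_ne_zero_of_mem (a := x) ⟨0, rfl⟩ hfin)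
  rw [div_eq_iff hpos]
  simp only [h]
  rw [finsum_mem_add_distrib hfin, finsum_mem_sub_distrib (fun y => g (τ y)) g hfin, hsum,
    sub_self, add_zero,
    finsum_mem_eq_finite_toFinset_sum _ hfin, Finset.sum_const, nsmul_eq_mul,
    Set.ncard_eq_toFinset_card _ hfin, mul_comm]

end Rowmotion321

theorem theorem4p1 (n : ℕ) (hn : 1 ≤ n) :
    Function.Bijective (Rowmotion321.Exc n) ∧
      Rowmotion321.IsMesic (Rowmotion321.rowmotion n) (fun π => (Rowmotion321.fp π : ℚ)) 1 := by
  refine ⟨⟨Rowmotion321.Exc_injective n, Rowmotion321.Exc_surjective n⟩,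
    Rowmotion321.isMesic_of_coboundary (Rowmotion321.rowmotion_bijective n)
      (g := fun π => ((Rowmotion321.Exc n π).1.ncard : ℚ)) fun π => ?_⟩
  have h := Rowmotion321.ncard_antichainRowmotion_Exc hn π
  rw [← Rowmotion321.Exc_rowmotion] at h
  have h' : (((Rowmotion321.Exc n (Rowmotion321.rowmotion n π)).1.ncard : ℚ) + 1) =
      (Rowmotion321.Exc n π).1.ncard + Rowmotion321.fp π := by exact_mod_cast h
  linarith
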